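/- **Model.** Time is $\mathbb T=\mathbb N\cup\{0\}$ (discrete model) or $\mathbb T=\mathbb R_{\ge 0}$ (continuous model). A context $\gamma$ consists of a directed graph on a (possibly infinite) set of agents $\mathbb I_\gamma$ with edge weights $b_\gamma(i,j)\in(\mathbb T\setminus\{0\})\cup\{\infty\}$, a set of states for each agent, a set of messages, and a set of external inputs, each observed by one agent. A protocol gives each agent a set of initial states and a deterministic rule which maps its state just before the current time and the inputs and messages it observes at the current time (and possibly the current time itself) to its new state, a set of messages sent to out-neighbours, and whether it responds. In the discrete model agents act at every time. In the continuous model an agent acts exactly at $t=0$ and at suprema of non-empty sets of times at each of which it observes an event; when acting it may set a timer for a later time, which rings (an event, which it observes) if the agent has not acted strictly in between; the state just before $t>0$ is given by a fixed pseudo-limit (depending only on the states in a left neighbourhood of $t$, and equal to $s$ if these are constantly $s$), and an agent that does not act at $t$ has at $t$ its state just before $t$. In a run, each external input occurs at most once; a message sent by $i$ to $j$ at $t$ is delivered exactly once, at some $t'$ with $t<t'\le t+b_\gamma(i,j)$ (early if $t'<t+b_\gamma(i,j)$); only sent messages are delivered. The ND events of a run $r$ are its external inputs and early deliveries (with their occurrence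 times); $\mathit{ND}(r,t)$ is the set of those occurring no later than $t$. **Causality.** Syncausality $\rightsquigarrow_r$ is the least preorder on agent-time pairs such that $(i,t)\rightsquigarrow_r(i,t')$ for $t\le t'$, $(i,t)\rightsquigarrow_r(j,t')$ whenever a message sent by $i$ at $t$ is delivered to $j$ at $t'$ in $r$, and $(i,t)\rightsquigarrow_r(j,t+b_\gamma(i,j))$ for every edge $(i,j)$ with $b_\gamma(i,j)<\infty$. Bound guarantee $\dashrightarrow$ is defined likewise, without the message clause. For an event $e$ observed by $i_e$ at $t_e$, "$e\rightsquigarrow_r(i,t)$" and "$e\dashrightarrow(i,t)$" refer to $(i_e,t_e)$; for events, $e\rightsquigarrow_r e'$ means that $e=e'$, or that $e'$ is the delivery of a message sent by some $i$ at some $t$ with $e\rightsquigarrow_r(i,t)$. An $\tilde e$-broom for $I$ by $t$ in $r$ is an ND event $e$ of $r$ such that $\tilde e$ occurs in $r$, $\tilde e\rightsquigarrow_r e$, and $e\dashrightarrow(i,t)$ for every $i\in I$. **Protocols.** A run is $\tilde e$-triggered if $\tilde e$ occurs in it. $P$ solves simultaneous response $\mathit{SR}(\tilde e,I)$ if in each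 $\tilde e$-triggered run $r$ each $i\in I$ responds exactly once, all at a common time $t_r$, and in the other runs no agent of $I$ responds. For runs $r,r'$ of $P$ write $r'\subseteq^t r$ if $r$ and $r'$ use the same initial states and $\mathit{ND}(r',t)\subseteq\mathit{ND}(r,t)$. $P$ is a finite-influence protocol if whenever an agent $i$ responds at $t$ in a run $r$ of $P$, there is a run $r'\subseteq^t r$ of $P$ with $\mathit{ND}(r',t)$ finite in which $i$ also responds at $t$. In the continuous model it is assumed, as part of the model, that the runs of $P$ satisfy: (a) *no foresight*: for every run $r$ and all $t,d\in\mathbb T$ there is a run $r'$ with the same initial states which coincides with $r$ on $[0,t]$, has no external inputs after $t$, and in which every early delivery after $t$ takes place at least $d$ time units after the message was sent; (b) *no extrasensory perception*: for every run $r$, time $t$ and agent $i$ there is a run $r'\subseteq^t r$ with $\mathit{ND}(r',t)=\{e\in\mathit{ND}(r,t): e\rightsquigarrow_r(i,t)\}$ such that the states of $i$ and the events observed by $i$ are the same in $r$ and $r'$ at all times up to and including $t$. In the discrete model nothing is assumed in addition. **Theorem (Broom, finite influence).** In the discrete model as well as in the continuous model, let $\gamma$ be a context, let $I\subseteq\mathbb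 I_\gamma$ be an arbitrary (possibly infinite) set of agents, let $\tilde e$ be an external input, and let $P$ be a finite-influence protocol solving $\mathit{SR}(\tilde e,I)$. Then every $\tilde e$-triggered run $r$ of $P$ contains an $\tilde e$-broom for $I$ by the common response time $t_r$. -/

import Mathlib

open scoped NNReal

universe u v w x

namespace Coordination



/-! ### Contexts, events and histories

Everything in this part is common to the discrete-time model (`T = ℕ`) and to the
continuous-time model (`T = ℝ≥0`). -/

/-- A context with set of times `T`: a directed graph on the agents whose edges carry positive,
possibly infinite, bounds on message delivery times; the legal states of each agent; the possible
messages; and the possible external inputs, each with the agent that observes it. There may be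
infinitely many agents. The values of `bound` off the edges are irrelevant. -/
structure Context (T : Type) [AddCommMonoid T] [LinearOrder T] where
  Agent : Type u
  State : Agent → Type v
  Msg : Type w
  Input : Type x
  /-- The edge relation: `i` may send messages to `j`. -/
  Edge : Agent → Agent → Prop
  bound : Agent → Agent → WithTop T
  bound_pos : ∀ i j, Edge i j → 0 < bound i j
  /-- The agent observing an external input. -/
  inputAgent : Input → Agent

/-- Events. `delivery m t i j` is the delivery to `j` of the message `m` sent by `i` at time `t`;
`ring i` is the ringing of a timer of `i` (it occurs in the continuous-time model only). -/
inductive Event {T : Type} [AddCommMonoid T] [LinearOrder T] (γ : Context.{u, v, w, x} T) where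
  | input (a : γ.Input)
  | delivery (m : γ.Msg) (t : T) (i j : γ.Agent)
  | ring (i : γ.Agent)

/-- The agent by which an event is observed. -/
def Event.observer {T : Type} [AddCommMonoid T] [LinearOrder T] {γ : Context.{u, v, w, x} T} :
    Event γ → γ.Agent
  | .input a => γ.inputAgent a
  | .delivery _ _ _ j => j
  | .ring i => i

/-- A history: the initial states used, the set of the events taking place at each time (the state
of the environment), and the state of each agent at each time (after acting at that time). The runs
of a protocol are the histories that are consistent with it. -/
structure History {T : Type} [AddCommMonoid T] [LinearOrder T] (γ : Context.{u, v, w, x} T) where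
  init : ∀ i : γ.Agent, γ.State i
  env : T → Set (Event γ)
  state : T → ∀ i : γ.Agent, γ.State i

section General

variable {T : Type} [AddCommMonoid T] [LinearOrder T] {γ : Context.{u, v, w, x} T}

namespace History

/-- The events observed by `i` at time `t`. -/
def observed (r : History γ) (i : γ.Agent) (t : T) : Set (Event γ) :=
  {ev | ev ∈ r.env t ∧ ev.observer = i}

/-- The external inputs observed by `i` at time `t`. -/
def inputsAt (r : History γ) (i : γ.Agent) (t : T) : Set {a : γ.Input // γ.inputAgent a = i} :=
  {a | Event.input a.1 ∈ r.env t}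

/-- The messages, paired with their senders, that are delivered to `i` at time `t`. -/
def receivedAt (r : History γ) (i : γ.Agent) (t : T) : Set (γ.Msg × γ.Agent) :=
  {p | ∃ t₀ : T, Event.delivery p.1 t₀ p.2 i ∈ r.env t}

/-- The non-deterministic (ND) events of a history, each paired with its occurrence time: the
external inputs, and the early deliveries, i.e. the deliveries strictly before the time
guaranteed by the bound. -/
def ND (r : History γ) : Set (Event γ × T) :=
  {p | p.1 ∈ r.env p.2 ∧
    ((∃ a, p.1 = Event.input a) ∨
      ∃ m t i j, p.1 = Event.delivery m t i j ∧
        (p.2 : WithTop T) < (t : WithTop T) + γ.bound i j)}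

/-- The ND events occurring no later than `t`. -/
def NDUntil (r : History γ) (t : T) : Set (Event γ × T) :=
  {p | p ∈ r.ND ∧ p.2 ≤ t}

/-- The history is triggered by the external input `a`: this input occurs in it. -/
def Triggered (r : History γ) (a : γ.Input) : Prop :=
  ∃ t : T, (Event.input a, t) ∈ r.ND

/-- Syncausality between agent-time pairs. -/
inductive Syncausal (r : History γ) : γ.Agent × T → γ.Agent × T → Prop
  | locality (i : γ.Agent) {t t' : T} (h : t ≤ t') : Syncausal r (i, t) (i, t')
  | message {m : γ.Msg} {i j : γ.Agent} {t t' : T} (h : t < t')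
      (hd : Event.delivery m t i j ∈ r.env t') : Syncausal r (i, t) (j, t')
  | guarantee {i j : γ.Agent} (t : T) {d : T} (he : γ.Edge i j) (hb : γ.bound i j = (d : WithTop T)) :
      Syncausal r (i, t) (j, t + d)
  | trans {θ₁ θ₂ θ₃ : γ.Agent × T} (h₁ : Syncausal r θ₁ θ₂) (h₂ : Syncausal r θ₂ θ₃) :
      Syncausal r θ₁ θ₃

/-- Syncausality from an event (with its occurrence time) to an agent-time pair. -/
def SyncausalFrom (r : History γ) (e : Event γ × T) (θ : γ.Agent × T) : Prop :=
  r.Syncausal (e.1.observer, e.2) θ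

/-- Syncausality between events (with their occurrence times): either they are the same event, or
the second is the delivery of a message whose sending is causally preceded by the first. -/
def SyncausalEvent (r : History γ) (e₁ e₂ : Event γ × T) : Prop :=
  e₁ = e₂ ∨ ∃ m t i j, e₂.1 = Event.delivery m t i j ∧ r.SyncausalFrom e₁ (i, t)

/-- The ND past of the agent-time pair `(i, t)`. -/
def PND (r : History γ) (i : γ.Agent) (t : T) : Set (Event γ × T) :=
  {e | e ∈ r.ND ∧ r.SyncausalFrom e (i, t)}

/-- The histories have the same states of `i`, and the same events observed by `i`, up to and
including time `t`. -/
def SameView (r r' : History γ) (i : γ.Agent) (t : T) : Prop :=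
  ∀ s ≤ t, r.state s i = r'.state s i ∧ r.observed i s = r'.observed i s

end History

/-- Bound guarantee between agent-time pairs. -/
inductive BoundGuarantee (γ : Context.{u, v, w, x} T) : γ.Agent × T → γ.Agent × T → Prop
  | locality (i : γ.Agent) {t t' : T} (h : t ≤ t') : BoundGuarantee γ (i, t) (i, t')
  | guarantee {i j : γ.Agent} (t : T) {d : T} (he : γ.Edge i j) (hb : γ.bound i j = (d : WithTop T)) :
      BoundGuarantee γ (i, t) (j, t + d)
  | trans {θ₁ θ₂ θ₃ : γ.Agent × T} (h₁ : BoundGuarantee γ θ₁ θ₂) (h₂ : BoundGuarantee γ θ₂ θ₃) :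
      BoundGuarantee γ θ₁ θ₃

/-- The ND event `e` is an `a`-broom in `r` for the agents of `I` by the times `τ`. -/
def IsBroom (r : History γ) (a : γ.Input) (I : Set γ.Agent) (τ : I → T) (e : Event γ × T) : Prop :=
  e ∈ r.ND ∧
  (∃ s : T, (Event.input a, s) ∈ r.ND ∧ r.SyncausalEvent (Event.input a, s) e) ∧
  ∀ i : I, BoundGuarantee γ (e.1.observer, e.2) (i.1, τ i)

/-- What a protocol generates: its set of runs, and who responds when in each of them. Response
problems, subruns and finite influence involve a protocol only through these data. -/
structure Behaviour (γ : Context.{u, v, w, x} T) where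
  runs : Set (History γ)
  Responds : History γ → γ.Agent → T → Prop

namespace Behaviour

/-- The eventual response problem: in each `a`-triggered run each agent of `I` responds exactly
once; in the other runs none of them responds. -/
structure EventualResponse (B : Behaviour γ) (a : γ.Input) (I : Set γ.Agent) : Prop where
  triggered : ∀ r ∈ B.runs, r.Triggered a → ∀ i ∈ I, ∃! t, B.Responds r i t
  untriggered : ∀ r ∈ B.runs, ¬ r.Triggered a → ∀ i ∈ I, ∀ t, ¬ B.Responds r i t

/-- The simultaneous response problem: eventual response, with the same response time for all
the agents of `I` in each triggered run. -/
structure SimultaneousResponse (B : Behaviour γ) (a : γ.Input) (I : Set γ.Agent) : Prop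
    extends B.EventualResponse a I where
  simultaneous : ∀ r ∈ B.runs, r.Triggered a → ∃ t, ∀ i ∈ I, B.Responds r i t

/-- `r'` is a `t`-subrun of `r`: a run with the same initial states, all of whose ND events up to
`t` occur (at the same times) in `r`. -/
def Subrun (B : Behaviour γ) (t : T) (r' r : History γ) : Prop :=
  r' ∈ B.runs ∧ r'.init = r.init ∧ r'.NDUntil t ⊆ r.NDUntil t

/-- The `t`-subruns of `r` whose set of ND events up to `t` is `E`. -/
def restrict (B : Behaviour γ) (r : History γ) (t : T) (E : Set (Event γ × T)) :
    Set (History γ) :=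
  {r' | B.Subrun t r' r ∧ r'.NDUntil t = E}

/-- The `t`-retainable sets of ND events of `r`. -/
def RND (B : Behaviour γ) (r : History γ) (t : T) : Set (Set (Event γ × T)) :=
  {E | ∃ r', B.Subrun t r' r ∧ r'.NDUntil t = E}

/-- Finite influence: whenever an agent responds, finitely many ND events, forming a retainable
set, suffice for this response. -/
def FiniteInfluence (B : Behaviour γ) : Prop :=
  ∀ r ∈ B.runs, ∀ (i : γ.Agent) (t : T), B.Responds r i t →
    ∃ E ∈ B.RND r t, E.Finite ∧ ∃ r' ∈ B.restrict r t E, B.Responds r' i t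

/-- No foresight: every run may be continued, after any time `t`, without external inputs and
with no early delivery less than `d` time units after the sending of the message. -/
def NoForesight (B : Behaviour γ) : Prop :=
  ∀ r ∈ B.runs, ∀ t d : T, ∃ r' ∈ B.runs,
    (r'.init = r.init ∧ ∀ s ≤ t, r'.env s = r.env s ∧ r'.state s = r.state s) ∧
    (∀ s, t < s → ∀ a : γ.Input, Event.input a ∉ r'.env s) ∧
    ∀ s, t < s → ∀ m t₀ i j, (Event.delivery m t₀ i j, s) ∈ r'.ND → t₀ + d ≤ s

/-- No extrasensory perception: for every agent `i` and time `t`, the ND past of `(i, t)` is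
`t`-retainable, by a run that `i` cannot distinguish from the given one up to time `t`. -/
def NoExtrasensoryPerception (B : Behaviour γ) : Prop :=
  ∀ r ∈ B.runs, ∀ (t : T) (i : γ.Agent), ∃ r' ∈ B.restrict r t (r.PND i t), r.SameView r' i t

/-- Each `a`-triggered run contains an `a`-broom for `I` by the common response time of `I`. -/
def HasBrooms (B : Behaviour γ) (a : γ.Input) (I : Set γ.Agent) : Prop :=
  ∀ r ∈ B.runs, r.Triggered a →
    ∃ t : T, (∀ i ∈ I, B.Responds r i t) ∧ ∃ e, IsBroom r a I (fun _ => t) e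

end Behaviour

/-- The properties of the environment common to both models, where `Sent m t i j` says that `i`
sends the message `m` to its neighbour `j` at time `t`: each external input occurs at most once;
each sent message is delivered exactly once, later, within its bound; only sent messages are
delivered. -/
structure LegalEnv (r : History γ) (Sent : γ.Msg → T → γ.Agent → γ.Agent → Prop) : Prop where
  input_once : ∀ a s s', Event.input a ∈ r.env s → Event.input a ∈ r.env s' → s = s'
  delivered : ∀ m t i j, Sent m t i j →
    ∃ t', t < t' ∧ (t' : WithTop T) ≤ (t : WithTop T) + γ.bound i j ∧
      ∀ s, Event.delivery m t i j ∈ r.env s ↔ s = t'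
  sent : ∀ m t i j s, Event.delivery m t i j ∈ r.env s → Sent m t i j

/-- What `i` does when acting: its new state, the messages it sends, each to a neighbour, and
whether it responds. -/
structure Action (γ : Context.{u, v, w, x} T) (i : γ.Agent) where
  newState : γ.State i
  messages : Set (γ.Msg × {j : γ.Agent // γ.Edge i j})
  respond : Bool

end General

/-! ### The discrete-time model -/

/-- A protocol in the discrete-time model: for each agent, the possible initial states, and the
action as a function of the previous state, the external inputs and messages observed, and the
current time. Protocols for a model without a shared clock are those whose actions do not depend on
the time argument. -/
structure DiscreteProtocol (γ : Context.{u, v, w, x} ℕ) where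
  initial : ∀ i : γ.Agent, Set (γ.State i)
  act : ∀ i : γ.Agent, γ.State i → Set {a : γ.Input // γ.inputAgent a = i} →
    Set (γ.Msg × γ.Agent) → ℕ → Action γ i

namespace DiscreteProtocol

variable {γ : Context.{u, v, w, x} ℕ}

/-- The state of `i` just before time `t`. -/
def prev (r : History γ) (i : γ.Agent) : ℕ → γ.State i
  | 0 => r.init i
  | t + 1 => r.state t i

/-- The action of `i` at time `t`. -/
def action (P : DiscreteProtocol γ) (r : History γ) (i : γ.Agent) (t : ℕ) : Action γ i :=
  P.act i (prev r i t) (r.inputsAt i t) (r.receivedAt i t) t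

/-- The runs of a protocol in the discrete-time model. -/
structure IsRun (P : DiscreteProtocol γ) (r : History γ) : Prop where
  init_mem : ∀ i, r.init i ∈ P.initial i
  state_eq : ∀ i t, r.state t i = (P.action r i t).newState
  legal : LegalEnv r fun m t i j => ∃ h : γ.Edge i j, (m, ⟨j, h⟩) ∈ (P.action r i t).messages
  no_timers : ∀ t i, Event.ring i ∉ r.env t

/-- The runs and the responses of a protocol. -/
def behaviour (P : DiscreteProtocol γ) : Behaviour γ where
  runs := {r | P.IsRun r}
  Responds r i t := (P.action r i t).respond = true

end DiscreteProtocol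

/-! ### The continuous-time model -/

/-- A pseudo-limit on `S`: it depends only on the values of a function in a left neighbourhood of
`0`, and it sends a constant function to its value. -/
structure PseudoLimit (S : Type v) where
  lim : (Set.Ioo (-1 : ℝ) 0 → S) → S
  lim_congr : ∀ (f g : Set.Ioo (-1 : ℝ) 0 → S) (ε : ℝ), 0 < ε →
    (∀ y : Set.Ioo (-1 : ℝ) 0, -ε < y.1 → f y = g y) → lim f = lim g
  lim_const : ∀ s : S, lim (fun _ => s) = s

/-- An action in the continuous-time model: additionally, a timer may be set for a given time. (It
has no effect unless this time is in the future.) -/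
structure TimedAction (γ : Context.{u, v, w, x} ℝ≥0) (i : γ.Agent) extends Action γ i where
  timer : Option ℝ≥0

/-- A protocol in the continuous-time model: the action of an agent depends on its state just before
the current time, on the external inputs and messages observed, on whether a timer rings, and on
the current time. Protocols for a model without a shared clock are a special case. -/
structure ContinuousProtocol (γ : Context.{u, v, w, x} ℝ≥0) where
  initial : ∀ i : γ.Agent, Set (γ.State i)
  act : ∀ i : γ.Agent, γ.State i → Set {a : γ.Input // γ.inputAgent a = i} →
    Set (γ.Msg × γ.Agent) → Prop → ℝ≥0 → TimedAction γ i

namespace ContinuousProtocol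

variable {γ : Context.{u, v, w, x} ℝ≥0}

/-- `i` is enabled at `t`: either `t = 0`, or `t` is the supremum of a set of times at each of which
`i` observes an event. -/
def Enabled (r : History γ) (i : γ.Agent) (t : ℝ≥0) : Prop :=
  t = 0 ∨ ∃ A : Set ℝ≥0, A.Nonempty ∧ (∀ s ∈ A, (r.observed i s).Nonempty) ∧ IsLUB A t

open Classical in
/-- The state of `i` just before time `t`. (For `t < 1`, the values `r.state 0 i` with which the
argument of the pseudo-limit is padded are irrelevant.) -/
noncomputable def prev (L : ∀ i : γ.Agent, PseudoLimit (γ.State i)) (r : History γ) (i : γ.Agent)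
    (t : ℝ≥0) : γ.State i :=
  if t = 0 then r.init i
  else (L i).lim fun y => r.state (Real.toNNReal ((t : ℝ) + y.1)) i

/-- The action of `i` at time `t` if it is enabled then. -/
noncomputable def action (P : ContinuousProtocol γ) (L : ∀ i : γ.Agent, PseudoLimit (γ.State i))
    (r : History γ) (i : γ.Agent) (t : ℝ≥0) : TimedAction γ i :=
  P.act i (prev L r i t) (r.inputsAt i t) (r.receivedAt i t) (Event.ring i ∈ r.env t) t

/-- The runs of a protocol in the continuous-time model. -/
structure IsRun (P : ContinuousProtocol γ) (L : ∀ i : γ.Agent, PseudoLimit (γ.State i))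
    (r : History γ) : Prop where
  init_mem : ∀ i, r.init i ∈ P.initial i
  state_enabled : ∀ i t, Enabled r i t → r.state t i = (P.action L r i t).newState
  state_not_enabled : ∀ i t, ¬ Enabled r i t → r.state t i = prev L r i t
  legal : LegalEnv r fun m t i j =>
    Enabled r i t ∧ ∃ h : γ.Edge i j, (m, ⟨j, h⟩) ∈ (P.action L r i t).messages
  timers : ∀ i t, Event.ring i ∈ r.env t ↔
    ∃ t₀ < t, Enabled r i t₀ ∧ (P.action L r i t₀).timer = some t ∧
      ∀ s, t₀ < s → s < t → ¬ Enabled r i s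

/-- The runs and the responses of a protocol. -/
def behaviour (P : ContinuousProtocol γ) (L : ∀ i : γ.Agent, PseudoLimit (γ.State i)) :
    Behaviour γ where
  runs := {r | P.IsRun L r}
  Responds r i t := Enabled r i t ∧ (P.action L r i t).respond = true

end ContinuousProtocol

end Coordination

/-! By finite influence, a triggered run `r` with common response time `t` has `t`-subruns with
finitely many ND events up to `t` in which a fixed `i₀ ∈ I` responds at `t`. Choose one, `r'`, with
as few of these events as possible. For any `i ∈ I`, discarding the ND events outside the past of
`(i, t)` preserves the response of `i`, hence by simultaneity that of `i₀`. Minimality then says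
that nothing was discarded: every ND event of `r'` up to `t` syncausally reaches every `(i, t)`. The
trigger is among these events. Take the latest ND event preceded by it: a path from this event to
`(i, t)` cannot use a further early delivery, so it is a bound guarantee. This gives a broom in
`r'`, which is also one in `r` (`exists_broom_of_finite`, `hasBrooms`). The only model-dependent
ingredient is `ResponseFromPast`. In continuous time it follows from the two axioms on runs; in
discrete time the required run is built by recursion on time (`pastRun`). -/

namespace Coordination

section General

variable {T : Type} [AddCommMonoid T] [LinearOrder T] {γ : Context.{u, v, w, x} T}

/-! ### Syncausal paths and bound guarantees. -/

namespace History

/-- Messages travel along edges, forwards in time, and within their bounds. -/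
def BoundedDelivery (r : History γ) : Prop :=
  ∀ m t i j t', Event.delivery m t i j ∈ r.env t' →
    γ.Edge i j ∧ t < t' ∧ (t' : WithTop T) ≤ (t : WithTop T) + γ.bound i j

theorem NDUntil_congr {r r' : History γ} {t : T} (h : ∀ s ≤ t, r.env s = r'.env s) :
    r.NDUntil t = r'.NDUntil t := by
  ext ⟨e, s⟩
  simp only [NDUntil, ND, Set.mem_ofPred_eq]
  constructor <;> rintro ⟨⟨he, h'⟩, hs⟩ <;> refine ⟨⟨?_, h'⟩, hs⟩
  · rwa [← h s hs]
  · rwa [h s hs]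

theorem inputsAt_congr {r r' : History γ} {i : γ.Agent} {t : T}
    (h : r.observed i t = r'.observed i t) : r.inputsAt i t = r'.inputsAt i t := by
  ext a
  have := Set.ext_iff.1 h (Event.input a.1)
  simpa [observed, inputsAt, Event.observer, a.2] using this

theorem receivedAt_congr {r r' : History γ} {i : γ.Agent} {t : T}
    (h : r.observed i t = r'.observed i t) : r.receivedAt i t = r'.receivedAt i t := by
  ext p
  refine exists_congr fun s => ?_
  have := Set.ext_iff.1 h (Event.delivery p.1 s p.2 i)
  simpa [observed, Event.observer] using this

theorem ring_congr {r r' : History γ} {i : γ.Agent} {t : T}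
    (h : r.observed i t = r'.observed i t) :
    (Event.ring i ∈ r.env t) = (Event.ring i ∈ r'.env t) := by
  have := Set.ext_iff.1 h (Event.ring i)
  simpa [observed, Event.observer] using this

theorem mem_env_congr {r r' : History γ} {e : Event γ} {t : T}
    (h : r.observed e.observer t = r'.observed e.observer t) :
    e ∈ r.env t ↔ e ∈ r'.env t := by
  have := Set.ext_iff.1 h e
  simpa [observed] using this

theorem BoundedDelivery.not_early {r : History γ} (hr : r.BoundedDelivery) {m : γ.Msg} {t t' : T}
    {i j : γ.Agent} (hd : Event.delivery m t i j ∈ r.env t')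
    (h : ¬ (t' : WithTop T) < (t : WithTop T) + γ.bound i j) :
    ∃ d : T, γ.bound i j = (d : WithTop T) ∧ t' = t + d := by
  have heq := le_antisymm (hr m t i j t' hd).2.2 (not_lt.1 h)
  cases hb : γ.bound i j with
  | top => simp [hb] at heq
  | coe d =>
    rw [hb] at heq
    exact ⟨d, rfl, by exact_mod_cast heq⟩

theorem Syncausal.le [IsOrderedAddMonoid T] [CanonicallyOrderedAdd T] {r : History γ}
    {θ θ' : γ.Agent × T} (h : r.Syncausal θ θ') : θ.2 ≤ θ'.2 := by
  induction h with
  | locality i h => exact h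
  | message h hd => exact h.le
  | guarantee t he hb => exact le_self_add
  | trans _ _ h₁ h₂ => exact h₁.trans h₂

/-- A syncausal path either is a bound guarantee or passes through an early delivery. -/
theorem Syncausal.boundGuarantee_or [IsOrderedAddMonoid T] [CanonicallyOrderedAdd T]
    {r : History γ} (hr : r.BoundedDelivery) {θ θ' : γ.Agent × T} (h : r.Syncausal θ θ') :
    BoundGuarantee γ θ θ' ∨ ∃ m s i j t', (Event.delivery m s i j, t') ∈ r.ND ∧ s < t' ∧
      r.Syncausal θ (i, s) ∧ r.Syncausal (j, t') θ' := by
  induction h with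
  | locality i h => exact .inl (.locality i h)
  | @message m i j t t' h hd =>
    by_cases he : (t' : WithTop T) < (t : WithTop T) + γ.bound i j
    · exact .inr ⟨m, t, i, j, t', ⟨hd, .inr ⟨m, t, i, j, rfl, he⟩⟩, h, .locality i le_rfl,
        .locality j le_rfl⟩
    -- A delivery that is not early happens exactly at its bound, so it duplicates a guarantee step.
    · obtain ⟨d, hb, rfl⟩ := hr.not_early hd he
      exact .inl (.guarantee t (hr _ _ _ _ _ hd).1 hb)
  | guarantee t he hb => exact .inl (.guarantee t he hb)
  | trans h₁ h₂ ih₁ ih₂ =>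
    rcases ih₁ with ih₁ | ⟨m, s, i, j, t', hnd, hs, ha, hb⟩
    · rcases ih₂ with ih₂ | ⟨m, s, i, j, t', hnd, hs, ha, hb⟩
      · exact .inl (ih₁.trans ih₂)
      · exact .inr ⟨m, s, i, j, t', hnd, hs, h₁.trans ha, hb⟩
    · exact .inr ⟨m, s, i, j, t', hnd, hs, ha, hb.trans h₂⟩

/-- A path ending by `t` uses only deliveries by `t`. The early ones occur in `r` as well, and the
others are guarantee steps, which exist in every run. -/
theorem Syncausal.of_NDUntil_subset [IsOrderedAddMonoid T] [CanonicallyOrderedAdd T]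
    {r r' : History γ} (hr' : r'.BoundedDelivery) {t : T}
    (hsub : r'.NDUntil t ⊆ r.NDUntil t) {θ θ' : γ.Agent × T} (h : r'.Syncausal θ θ')
    (ht : θ'.2 ≤ t) : r.Syncausal θ θ' := by
  induction h with
  | locality i h => exact .locality i h
  | @message m i j s s' h hd =>
    by_cases he : (s' : WithTop T) < (s : WithTop T) + γ.bound i j
    · have := @hsub (Event.delivery m s i j, s') ⟨⟨hd, .inr ⟨m, s, i, j, rfl, he⟩⟩, ht⟩
      exact .message h this.1.1
    · obtain ⟨d, hb, rfl⟩ := hr'.not_early hd he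
      exact .guarantee s (hr' _ _ _ _ _ hd).1 hb
  | guarantee t he hb => exact .guarantee t he hb
  | trans h₁ h₂ ih₁ ih₂ => exact (ih₁ (h₂.le.trans ht)).trans (ih₂ ht)

/-- If all ND events of a finite set of ND events syncausally reach all of `I`, then the latest of
those preceded by the trigger reaches them with a bound guarantee. -/
theorem exists_broom_of_finite [IsOrderedAddMonoid T] [CanonicallyOrderedAdd T]
    {r : History γ} (hr : r.BoundedDelivery) {a : γ.Input} {I : Set γ.Agent} {s t : T}
    (hfin : (r.NDUntil t).Finite) (ha : (Event.input a, s) ∈ r.NDUntil t)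
    (hpast : ∀ i ∈ I, r.NDUntil t ⊆ r.PND i t) :
    ∃ e ∈ r.NDUntil t, r.SyncausalEvent (Event.input a, s) e ∧
      ∀ i ∈ I, BoundGuarantee γ (e.1.observer, e.2) (i, t) := by
  set S := {e ∈ r.NDUntil t | r.SyncausalEvent (Event.input a, s) e}
  have hS : S.Finite := hfin.subset fun e he => he.1
  obtain ⟨e, heS, hmax⟩ := Set.exists_max_image S (fun e => e.2) hS ⟨_, ha, .inl rfl⟩
  have hlocal : r.SyncausalFrom (Event.input a, s) (e.1.observer, e.2) := by
    rcases heS.2 with h | ⟨m, s', k, j, h, hk⟩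
    · rw [← h]
      exact .locality _ le_rfl
    · have hd : Event.delivery m s' k j ∈ r.env e.2 := h ▸ heS.1.1.1
      rw [h]
      exact hk.trans (.message (hr _ _ _ _ _ hd).2.1 hd)
  refine ⟨e, heS.1, heS.2, fun i hi => ?_⟩
  have hsync : r.Syncausal (e.1.observer, e.2) (i, t) := (hpast i hi heS.1).2
  rcases hsync.boundGuarantee_or hr with h | ⟨m, s', k, j, t', hnd, hs', hk, hj⟩
  · exact h
  -- The early delivery on the path is preceded by the trigger through `e`, so it is no later than
  -- `e`. But its message is sent no earlier than `e` and delivered strictly later.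
  · have hle : t' ≤ e.2 := hmax (Event.delivery m s' k j, t')
      ⟨⟨hnd, hj.le⟩, .inr ⟨m, s', k, j, rfl, hlocal.trans hk⟩⟩
    exact absurd (hk.le.trans_lt hs') hle.not_gt

end History

theorem LegalEnv.boundedDelivery {r : History γ} {Sent : γ.Msg → T → γ.Agent → γ.Agent → Prop}
    (h : LegalEnv r Sent) (hE : ∀ m t i j, Sent m t i j → γ.Edge i j) : r.BoundedDelivery := by
  intro m t i j t' hd
  have hs := h.sent _ _ _ _ _ hd
  obtain ⟨t'', h₁, h₂, h₃⟩ := h.delivered _ _ _ _ hs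
  obtain rfl := (h₃ t').1 hd
  exact ⟨hE _ _ _ _ hs, h₁, h₂⟩

/-! ### Minimal subruns and the existence of brooms. -/

namespace Behaviour

/-- Responses at time `t` depend on the ND past only: they are kept in a run without further ND
events up to `t`, and without further external inputs after `t`. -/
def ResponseFromPast (B : Behaviour γ) : Prop :=
  ∀ r ∈ B.runs, ∀ (i : γ.Agent) (t : T), B.Responds r i t →
    ∃ r' ∈ B.restrict r t (r.PND i t), B.Responds r' i t ∧
      ∀ s, t < s → ∀ a : γ.Input, Event.input a ∉ r'.env s

/-- Agents of `I` respond only in triggered runs, and only once there, so one response at `t`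
identifies `t` as the common response time. -/
theorem SimultaneousResponse.responds {B : Behaviour γ} {a : γ.Input} {I : Set γ.Agent}
    (h : B.SimultaneousResponse a I) {r : History γ} (hr : r ∈ B.runs) {i : γ.Agent} (hi : i ∈ I)
    {t : T} (hresp : B.Responds r i t) : r.Triggered a ∧ ∀ j ∈ I, B.Responds r j t := by
  have htr : r.Triggered a := by
    by_contra hn
    exact h.untriggered r hr hn i hi t hresp
  obtain ⟨t', ht'⟩ := h.simultaneous r hr htr
  obtain rfl := (h.triggered r hr htr i hi).unique hresp (ht' i hi)
  exact ⟨htr, ht'⟩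

/-- Among the subruns in which `i` responds at `t`, there is one with finitely many, and as few as
possible, ND events up to `t`. -/
theorem FiniteInfluence.exists_minimal {B : Behaviour γ} (h : B.FiniteInfluence) {r : History γ}
    (hr : r ∈ B.runs) {i : γ.Agent} {t : T} (hresp : B.Responds r i t) :
    ∃ r', B.Subrun t r' r ∧ B.Responds r' i t ∧ (r'.NDUntil t).Finite ∧
      ∀ r'', B.Subrun t r'' r → B.Responds r'' i t → r''.NDUntil t ⊆ r'.NDUntil t →
        r''.NDUntil t = r'.NDUntil t := by
  obtain ⟨E, -, hE, r₀, ⟨hsub, hND⟩, hresp₀⟩ := h r hr i t hresp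
  -- `ncard` vanishes on infinite sets, so the minimum is taken only over subruns with finitely many
  -- ND events up to `t`.
  have hwf := (measure fun r : History γ => (r.NDUntil t).ncard).wf
  obtain ⟨r', ⟨h₁, h₂, h₃⟩, hmin⟩ := hwf.has_min
    {r' | B.Subrun t r' r ∧ B.Responds r' i t ∧ (r'.NDUntil t).Finite}
    ⟨r₀, hsub, hresp₀, hND ▸ hE⟩
  refine ⟨r', h₁, h₂, h₃, fun r'' k₁ k₂ k₃ => ?_⟩
  have := hmin r'' ⟨k₁, k₂, h₃.subset k₃⟩
  exact Set.eq_of_subset_of_ncard_le k₃ (not_lt.1 this) h₃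

theorem hasBrooms [IsOrderedAddMonoid T] [CanonicallyOrderedAdd T] {B : Behaviour γ} {a : γ.Input}
    {I : Set γ.Agent} (hB : ∀ r ∈ B.runs, r.BoundedDelivery) (hpast : B.ResponseFromPast)
    (hSR : B.SimultaneousResponse a I) (hFI : B.FiniteInfluence) : B.HasBrooms a I := by
  intro r hr htr
  obtain ⟨t, ht⟩ := hSR.simultaneous r hr htr
  refine ⟨t, ht, ?_⟩
  rcases I.eq_empty_or_nonempty with rfl | ⟨i₀, hi₀⟩
  -- For empty `I` the trigger itself is a broom.
  · obtain ⟨s, hs⟩ := htr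
    exact ⟨_, hs, ⟨s, hs, .inl rfl⟩, fun i => absurd i.2 (Set.notMem_empty _)⟩
  obtain ⟨r', hsub, hresp, hfin, hmin⟩ := hFI.exists_minimal hr (ht i₀ hi₀)
  have key : ∀ i ∈ I, r'.NDUntil t ⊆ r'.PND i t ∧
      ∃ s, (Event.input a, s) ∈ r'.NDUntil t := by
    intro i hi
    obtain ⟨r'', ⟨⟨hrun, hinit, hND⟩, hE⟩, hresp'', hinp⟩ :=
      hpast r' hsub.1 i t ((hSR.responds hsub.1 hi₀ hresp).2 i hi)
    obtain ⟨⟨s, hs⟩, hall⟩ := hSR.responds hrun hi hresp''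
    -- Simultaneity turns the response of `i` in `r''` into one of `i₀`, so `r''` competes with the
    -- minimal `r'`.
    have heq := hmin r'' ⟨hrun, hinit.trans hsub.2.1, hND.trans hsub.2.2⟩ (hall i₀ hi₀) hND
    refine ⟨(heq.symm.trans hE).le, s, ?_⟩
    rw [← heq]
    -- `r''` is triggered but has no inputs after `t`, so the trigger occurs by `t`.
    exact ⟨hs, not_lt.1 fun hlt => hinp s hlt a hs.1⟩
  obtain ⟨-, s, hs⟩ := key i₀ hi₀
  obtain ⟨e, he, hcause, hguar⟩ :=
    History.exists_broom_of_finite (hB r' hsub.1) hfin hs fun i hi => (key i hi).1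
  refine ⟨e, (hsub.2.2 he).1, ⟨s, (hsub.2.2 hs).1, ?_⟩, fun i => hguar i.1 i.2⟩
  rcases hcause with h | ⟨m, s', k, j, h, hk⟩
  · exact .inl h
  -- The message delivered at `e` was sent before `t`, so the path from the trigger to its sending
  -- transfers from `r'` to `r`.
  · have hlt : s' < e.2 := (hB r' hsub.1 m s' k j e.2 (h ▸ he.1.1)).2.1
    exact .inr ⟨m, s', k, j, h,
      History.Syncausal.of_NDUntil_subset (hB r' hsub.1) hsub.2.2 hk (hlt.le.trans he.2)⟩

end Behaviour

end General

/-! ### Responses from the ND past in continuous time. -/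

namespace ContinuousProtocol

variable {γ : Context.{u, v, w, x} ℝ≥0}

theorem enabled_of_sameView {r r' : History γ} {i : γ.Agent} {t : ℝ≥0} (h : r.SameView r' i t)
    (he : Enabled r i t) : Enabled r' i t := by
  refine he.imp_right fun ⟨A, hne, hA, hlub⟩ => ⟨A, hne, fun s hs => ?_, hlub⟩
  rw [← (h s (hlub.1 hs)).2]
  exact hA s hs

theorem prev_congr (L : ∀ i : γ.Agent, PseudoLimit (γ.State i)) {r r' : History γ} {i : γ.Agent}
    {t : ℝ≥0} (hinit : r.init = r'.init) (h : r.SameView r' i t) :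
    prev L r i t = prev L r' i t := by
  unfold prev
  split_ifs with ht
  · rw [hinit]
  · congr 1
    funext y
    -- As `y < 0`, only times up to `t` are sampled; truncation of `t + y` at `0` does not change
    -- this.
    refine (h _ ?_).1
    rw [Real.toNNReal_le_iff_le_coe]
    linarith [y.2.2]

theorem responds_of_sameView (P : ContinuousProtocol γ)
    (L : ∀ i : γ.Agent, PseudoLimit (γ.State i)) {r r' : History γ} {i : γ.Agent}
    {t : ℝ≥0} (hinit : r.init = r'.init) (h : r.SameView r' i t)
    (hresp : (P.behaviour L).Responds r i t) : (P.behaviour L).Responds r' i t := by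
  have hobs := (h t le_rfl).2
  refine ⟨enabled_of_sameView h hresp.1, ?_⟩
  rw [action, ← prev_congr L hinit h, ← History.inputsAt_congr hobs,
    ← History.receivedAt_congr hobs, ← History.ring_congr hobs]
  exact hresp.2

/-- No extrasensory perception removes the ND events outside the past without `i` noticing; no
foresight then removes the inputs after `t`. -/
theorem responseFromPast (P : ContinuousProtocol γ)
    (L : ∀ i : γ.Agent, PseudoLimit (γ.State i)) (hNF : (P.behaviour L).NoForesight)
    (hNE : (P.behaviour L).NoExtrasensoryPerception) : (P.behaviour L).ResponseFromPast := by
  intro r hr i t hresp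
  obtain ⟨r₁, ⟨⟨hrun₁, hinit₁, hsub₁⟩, hE₁⟩, hview₁⟩ := hNE r hr t i
  obtain ⟨r₂, hrun₂, ⟨hinit₂, hcoin⟩, hinp, -⟩ := hNF r₁ hrun₁ t 0
  have hND : r₂.NDUntil t = r₁.NDUntil t := History.NDUntil_congr fun s hs => (hcoin s hs).1
  have hview₂ : r₁.SameView r₂ i t := fun s hs => by
    simp only [History.observed, (hcoin s hs).1, (hcoin s hs).2, and_self]
  refine ⟨r₂, ⟨⟨hrun₂, hinit₂.trans hinit₁, hND.trans_subset hsub₁⟩, hND.trans hE₁⟩, ?_, hinp⟩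
  exact responds_of_sameView P L hinit₂.symm hview₂
    (responds_of_sameView P L hinit₁.symm hview₁ hresp)

theorem boundedDelivery (P : ContinuousProtocol γ)
    (L : ∀ i : γ.Agent, PseudoLimit (γ.State i)) {r : History γ} (hr : P.IsRun L r) :
    r.BoundedDelivery :=
  hr.legal.boundedDelivery fun _ _ _ _ h => h.2.1

end ContinuousProtocol

/-! ### Discrete runs with prescribed inputs and delivery times. -/

namespace DiscreteProtocol

variable {γ : Context.{u, v, w, x} ℕ}

/-- The events and the actions at time `n` when the external inputs are given by `inp` and the
delivery times of messages by `del`. -/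
noncomputable def simulate (P : DiscreteProtocol γ) (init : ∀ i : γ.Agent, γ.State i)
    (inp : γ.Input → ℕ → Prop) (del : γ.Msg → ℕ → γ.Agent → γ.Agent → ℕ) (n : ℕ) :
    Set (Event γ) × (∀ i : γ.Agent, Action γ i) :=
  let env : Set (Event γ) := {ev | (∃ a, ev = Event.input a ∧ inp a n) ∨
    ∃ m s i j, ev = Event.delivery m s i j ∧ del m s i j = n ∧
      -- Binding `s < n` here makes the proof available to the termination check.
      ∃ _ : s < n, ∃ h : γ.Edge i j,
        (m, ⟨j, h⟩) ∈ ((simulate P init inp del s).2 i).messages}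
  (env, fun i => P.act i
    (if _ : n = 0 then init i else ((simulate P init inp del (n - 1)).2 i).newState)
    {a | Event.input a.1 ∈ env} {p | ∃ s, Event.delivery p.1 s p.2 i ∈ env} n)
termination_by n
decreasing_by all_goals omega

/-- The history resulting from `simulate`. -/
noncomputable def simulation (P : DiscreteProtocol γ) (init : ∀ i : γ.Agent, γ.State i)
    (inp : γ.Input → ℕ → Prop) (del : γ.Msg → ℕ → γ.Agent → γ.Agent → ℕ) : History γ where
  init := init
  env n := (simulate P init inp del n).1
  state n i := ((simulate P init inp del n).2 i).newState

section Simulation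

variable {P : DiscreteProtocol γ} {init : ∀ i : γ.Agent, γ.State i}
    {inp : γ.Input → ℕ → Prop} {del : γ.Msg → ℕ → γ.Agent → γ.Agent → ℕ}

/-- The recursion carries actions along with events. This identifies them with the actions that the
protocol prescribes in the resulting history. -/
theorem action_simulation (i : γ.Agent) (n : ℕ) :
    P.action (simulation P init inp del) i n = (simulate P init inp del n).2 i := by
  have h : prev (simulation P init inp del) i n =
      if _ : n = 0 then init i else ((simulate P init inp del (n - 1)).2 i).newState := by
    cases n <;> rfl
  rw [action, h]
  conv_rhs => rw [simulate]
  have henv := congrArg Prod.fst (simulate.eq_1 P init inp del n)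
  simp only [History.inputsAt, History.receivedAt, simulation]
  rw [henv]

theorem input_mem_simulation {a : γ.Input} {n : ℕ} :
    Event.input a ∈ (simulation P init inp del).env n ↔ inp a n := by
  simp only [simulation]
  rw [simulate]
  simp

theorem delivery_mem_simulation {m : γ.Msg} {s n : ℕ} {i j : γ.Agent} :
    Event.delivery m s i j ∈ (simulation P init inp del).env n ↔
      del m s i j = n ∧ s < n ∧ ∃ h : γ.Edge i j,
        (m, ⟨j, h⟩) ∈ (P.action (simulation P init inp del) i s).messages := by
  simp only [action_simulation]
  simp only [simulation]
  rw [simulate]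
  simp only [Set.mem_ofPred_eq, reduceCtorEq, false_and, exists_false, false_or]
  constructor
  · rintro ⟨m', s', i', j', h, h₁, h₂, h₃⟩
    cases h
    exact ⟨h₁, h₂, h₃⟩
  · rintro ⟨h₁, h₂, h₃⟩
    exact ⟨m, s, i, j, rfl, h₁, h₂, h₃⟩

/-- Since messages arrive strictly after being sent, the events at time `n` depend only on earlier
actions, so inputs and admissible delivery times can be prescribed freely. -/
theorem isRun_simulation (hinit : ∀ i, init i ∈ P.initial i)
    (hinp : ∀ a s s', inp a s → inp a s' → s = s')
    (hdel : ∀ m s i j, γ.Edge i j → s < del m s i j ∧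
      WithTop.some (del m s i j) ≤ WithTop.some s + γ.bound i j) :
    P.IsRun (simulation P init inp del) where
  init_mem := hinit
  state_eq i t := by rw [action_simulation]; rfl
  legal :=
    { input_once := fun a s s' h h' =>
        hinp a s s' (input_mem_simulation.1 h) (input_mem_simulation.1 h')
      delivered := fun m t i j h => by
        obtain ⟨he, hm⟩ := h
        obtain ⟨h₁, h₂⟩ := hdel m t i j he
        refine ⟨del m t i j, h₁, h₂, fun s => ?_⟩
        rw [delivery_mem_simulation]
        constructor
        · exact fun h => h.1.symm
        · rintro rfl
          exact ⟨rfl, h₁, he, hm⟩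
      sent := fun m t i j s h => (delivery_mem_simulation.1 h).2.2 }
  no_timers t i := by
    simp only [simulation]
    rw [simulate]
    simp

end Simulation

theorem boundedDelivery (P : DiscreteProtocol γ) {r : History γ} (hr : P.IsRun r) :
    r.BoundedDelivery :=
  hr.legal.boundedDelivery fun _ _ _ _ h => h.1

theorem IsRun.delivery_unique {P : DiscreteProtocol γ} {r : History γ} (hr : P.IsRun r)
    {m : γ.Msg} {s n n' : ℕ} {i j : γ.Agent} (h : Event.delivery m s i j ∈ r.env n)
    (h' : Event.delivery m s i j ∈ r.env n') : n = n' := by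
  obtain ⟨t, -, -, ht⟩ := hr.legal.delivered _ _ _ _ (hr.legal.sent _ _ _ _ _ h)
  exact ((ht n).1 h).trans ((ht n').1 h').symm

theorem action_congr (P : DiscreteProtocol γ) {r r' : History γ} {i : γ.Agent} {n : ℕ}
    (hinit : r.init = r'.init) (h : r.SameView r' i n) :
    P.action r i n = P.action r' i n := by
  have hobs := (h n le_rfl).2
  have hprev : prev r i n = prev r' i n := by
    cases n with
    | zero => exact congrFun hinit i
    | succ n => exact (h n n.le_succ).1
  rw [action, action, hprev, History.inputsAt_congr hobs, History.receivedAt_congr hobs]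

/-! ### The discrete run generated by the ND past of an agent-time pair. -/

open Classical in
/-- The delivery times in which exactly the messages whose delivery belongs to `E` are early up to
time `t`. -/
noncomputable def deliveryTime (E : Set (Event γ × ℕ)) (t : ℕ) (m : γ.Msg) (s : ℕ)
    (i j : γ.Agent) : ℕ :=
  if h : ∃ n, (Event.delivery m s i j, n) ∈ E then h.choose
  else match γ.bound i j with
    -- With an infinite bound every delivery is early, so it is postponed beyond `t`; it must also
    -- come after the sending time `s`.
    | ⊤ => max s t + 1
    | (d : ℕ) => s + d

theorem deliveryTime_cases (E : Set (Event γ × ℕ)) (t : ℕ) (m : γ.Msg) (s : ℕ) (i j : γ.Agent) :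
    (Event.delivery m s i j, deliveryTime E t m s i j) ∈ E ∨
    ((∀ n, (Event.delivery m s i j, n) ∉ E) ∧
      ((γ.bound i j = ⊤ ∧ deliveryTime E t m s i j = max s t + 1) ∨
        ∃ d : ℕ, γ.bound i j = WithTop.some d ∧ deliveryTime E t m s i j = s + d)) := by
  unfold deliveryTime
  by_cases h : ∃ n, (Event.delivery m s i j, n) ∈ E
  · rw [dif_pos h]
    exact .inl h.choose_spec
  · rw [dif_neg h]
    refine .inr ⟨not_exists.1 h, ?_⟩
    cases hb : γ.bound i j with
    | top => exact .inl ⟨rfl, rfl⟩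
    | coe d => exact .inr ⟨d, rfl, rfl⟩

/-- The run with the initial states of `r` whose ND events up to time `t` are those in the ND past
of `(i, t)`. -/
noncomputable def pastRun (P : DiscreteProtocol γ) (r : History γ) (i : γ.Agent) (t : ℕ) :
    History γ :=
  simulation P r.init (fun a n => (Event.input a, n) ∈ r.PND i t) (deliveryTime (r.PND i t) t)

section PastRun

variable {P : DiscreteProtocol γ} {r : History γ} {i : γ.Agent} {t : ℕ}

theorem isRun_pastRun (hr : P.IsRun r) : P.IsRun (P.pastRun r i t) := by
  refine isRun_simulation hr.init_mem
    (fun a s s' h h' => hr.legal.input_once a s s' h.1.1 h'.1.1) fun m s k j he => ?_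
  rcases deliveryTime_cases (r.PND i t) t m s k j with h | ⟨-, ⟨hb, h⟩ | ⟨d, hb, h⟩⟩
  · exact (P.boundedDelivery hr m s k j _ h.1.1).2
  · rw [h, hb]
    exact ⟨by omega, by simp⟩
  · have hpos : 0 < d := by
      have := γ.bound_pos k j he
      rw [hb] at this
      exact WithTop.coe_lt_coe.1 this
    rw [h, hb]
    exact ⟨by omega, WithTop.coe_le_coe.2 le_rfl⟩

/-- Induction on time along the syncausal past of `(i, t)`. The sender of any message reaching `(k,
n)`, in either run, lies in this past, so it acts alike in both runs; the delivery times agree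
because early deliveries to the past are copied from `r` and the others happen at their bounds. -/
theorem sameView_pastRun (hr : P.IsRun r) {k : γ.Agent} {n : ℕ}
    (hk : r.Syncausal (k, n) (i, t)) : r.SameView (P.pastRun r i t) k n := by
  induction n using Nat.strong_induction_on generalizing k with
  | _ n ih =>
  have hmsg : ∀ j s, s < n → r.Syncausal (j, s) (i, t) →
      P.action r j s = P.action (P.pastRun r i t) j s :=
    fun j s hs hj => P.action_congr rfl (ih s hs hj)
  have hobs : r.observed k n = (P.pastRun r i t).observed k n := by
    ext ev
    simp only [History.observed, Set.mem_ofPred_eq]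
    refine and_congr_left fun hobserver => ?_
    subst hobserver
    cases ev with
    | ring k =>
      exact iff_of_false (hr.no_timers n k) ((isRun_pastRun hr).no_timers n k)
    | input a =>
      rw [pastRun, input_mem_simulation]
      exact ⟨fun h => ⟨⟨h, .inl ⟨a, rfl⟩⟩, hk⟩, fun h => h.1.1⟩
    | delivery m s j k =>
      change r.Syncausal (k, n) (i, t) at hk
      have hcase := deliveryTime_cases (r.PND i t) t m s j k
      constructor
      · intro hd
        obtain ⟨he, hlt, hle⟩ := P.boundedDelivery hr _ _ _ _ _ hd
        have hsent := hr.legal.sent _ _ _ _ _ hd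
        rw [hmsg j s hlt (.trans (.message hlt hd) hk)] at hsent
        rw [pastRun, delivery_mem_simulation]
        refine ⟨?_, hlt, hsent⟩
        rcases hcase with h | ⟨hn, hcase⟩
        · exact hr.delivery_unique h.1.1 hd
        -- An early delivery at `(k, n)` would belong to the ND past, so this one takes place at its
        -- bound in both runs.
        · have hlate : ¬ (n : WithTop ℕ) < (s : WithTop ℕ) + γ.bound j k := fun h =>
            hn n ⟨⟨hd, .inr ⟨m, s, j, k, rfl, h⟩⟩, hk⟩
          obtain ⟨d, hb, rfl⟩ := (P.boundedDelivery hr).not_early hd hlate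
          rcases hcase with ⟨hb', -⟩ | ⟨d', hb', h⟩
          · simp [hb] at hb'
          · rw [hb] at hb'
            rw [h, WithTop.coe_injective hb']
      · intro hd
        rw [pastRun, delivery_mem_simulation] at hd
        obtain ⟨hdel, hlt, he, hsent⟩ := hd
        rcases hcase with h | ⟨hn, ⟨hb, h⟩ | ⟨d, hb, h⟩⟩
        · exact hdel ▸ h.1.1
        · have : n ≤ t := hk.le
          omega
        · obtain rfl : n = s + d := hdel.symm.trans h
          -- The message is not yet known to be sent in `r`, so the sender is placed in the past by
          -- the guarantee step alone.
          have hjk : r.Syncausal (j, s) (k, s + d) := .guarantee s he hb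
          have hact := hmsg j s hlt (hjk.trans hk)
          rw [pastRun] at hact
          rw [← hact] at hsent
          obtain ⟨n', h₁, h₂, h₃⟩ := hr.legal.delivered m s j k ⟨he, hsent⟩
          have hd' := (h₃ n').2 rfl
          rw [hb] at h₂
          have h₂' : n' ≤ s + d := WithTop.coe_le_coe.1 h₂
          -- Were the delivery in `r` before the bound, it would be an early delivery in the ND past
          -- and its time would have been copied.
          rcases h₂'.lt_or_eq with hlt' | rfl
          · refine absurd ⟨⟨hd', .inr ⟨m, s, j, k, rfl, ?_⟩⟩, ?_⟩ (hn n')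
            · rw [hb]
              exact WithTop.coe_lt_coe.2 hlt'
            · exact History.Syncausal.trans (.locality k h₂') hk
          · exact hd'
  have hprev : ∀ s < n, r.SameView (P.pastRun r i t) k s := fun s hs =>
    ih s hs (.trans (.locality k hs.le) hk)
  intro s hs
  rcases hs.lt_or_eq with hlt | rfl
  · exact hprev s hlt s le_rfl
  · refine ⟨?_, hobs⟩
    have hp : prev r k s = prev (P.pastRun r i t) k s := by
      cases s with
      | zero => rfl
      | succ s => exact (hprev s s.lt_succ_self s le_rfl).1
    rw [hr.state_eq, (isRun_pastRun hr).state_eq, action, action, hp,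
      History.inputsAt_congr hobs, History.receivedAt_congr hobs]

theorem NDUntil_pastRun (hr : P.IsRun r) : (P.pastRun r i t).NDUntil t = r.PND i t := by
  ext ⟨ev, n⟩
  constructor
  · rintro ⟨⟨hev, ⟨a, rfl⟩ | ⟨m, s, k, j, rfl, hlt⟩⟩, hn⟩
    · exact input_mem_simulation.1 hev
    · obtain ⟨hdel, -, -⟩ := delivery_mem_simulation.1 hev
      simp only at hdel hlt hn
      rcases deliveryTime_cases (r.PND i t) t m s k j with h | ⟨-, ⟨hb, h⟩ | ⟨d, hb, h⟩⟩
      · rwa [hdel] at h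
      -- Messages with infinite bound arrive after `t` here, whereas `n ≤ t`.
      · omega
      · obtain rfl : n = s + d := hdel.symm.trans h
        rw [hb] at hlt
        exact absurd (WithTop.coe_lt_coe.1 hlt) (lt_irrefl _)
  · rintro ⟨⟨hev, h⟩, hsync⟩
    have hview := (sameView_pastRun hr hsync n le_rfl).2
    exact ⟨⟨(History.mem_env_congr hview).1 hev, h⟩, hsync.le⟩

end PastRun

theorem responseFromPast (P : DiscreteProtocol γ) : P.behaviour.ResponseFromPast := by
  intro r hr i t hresp
  have hND := NDUntil_pastRun (i := i) (t := t) hr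
  refine ⟨P.pastRun r i t, ⟨⟨isRun_pastRun hr, rfl, ?_⟩, hND⟩, ?_, fun s hs a h => ?_⟩
  · rw [hND]
    exact fun e he => ⟨he.1, he.2.le⟩
  · change (P.action (P.pastRun r i t) i t).respond = true
    rw [← P.action_congr (r := r) (r' := P.pastRun r i t) rfl (sameView_pastRun hr (.locality i le_rfl))]
    exact hresp
  -- All inputs of `pastRun` come from the ND past of `(i, t)`, hence occur by `t`.
  · have := (input_mem_simulation.1 h).2.le
    exact absurd this hs.not_ge

end DiscreteProtocol

end Coordination

theorem mainTheorem11 :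
    (∀ (γ : Coordination.Context.{u, v, w, x} ℕ) (I : Set γ.Agent) (a : γ.Input)
      (P : Coordination.DiscreteProtocol γ),
      P.behaviour.SimultaneousResponse a I →
      P.behaviour.FiniteInfluence →
      P.behaviour.HasBrooms a I) ∧
    (∀ (γ : Coordination.Context.{u, v, w, x} ℝ≥0)
      (L : ∀ i : γ.Agent, Coordination.PseudoLimit (γ.State i)) (I : Set γ.Agent) (a : γ.Input)
      (P : Coordination.ContinuousProtocol γ),
      (P.behaviour L).NoForesight →
      (P.behaviour L).NoExtrasensoryPerception →
      (P.behaviour L).SimultaneousResponse a I →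
      (P.behaviour L).FiniteInfluence →
      (P.behaviour L).HasBrooms a I) := by
  refine ⟨fun γ I a P hSR hFI => ?_, fun γ L I a P hNF hNE hSR hFI => ?_⟩
  · exact Coordination.Behaviour.hasBrooms (fun r hr => P.boundedDelivery hr)
      P.responseFromPast hSR hFI
  · exact Coordination.Behaviour.hasBrooms (fun r hr => P.boundedDelivery L hr)
      (P.responseFromPast L hNF hNE) hSR hFI
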